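/- Let $B=(B(u),\,0\le u\le 1)$ be a standard Brownian motion on $[0,1]$. For a function $f$ on $[0,1]$ let $\overline C_{[0,1]}f$ denote its least concave majorant, and let $\mathcal V(f)\subset(0,1)$ be the set of times of the vertices of $\overline C_{[0,1]}f$, i.e. of those $t\in(0,1)$ such that $\overline C_{[0,1]}f$ is not affine in any neighbourhood of $t$. Random subsets of $[0,1]$ are considered with the $\sigma$-algebra generated by the events that the set meets a given open set, and random functions on $[0,1]$ with the product $\sigma$-algebra. Then: (i) the random set of vertex times $\mathcal V(B)$ is independent of $B(1)$; (ii) the difference process $(\overline C_{[0,1]}B(u)-B(u),\ 0\le u\le 1)$ is independent of $B(1)$; (iii) for every real $b$ and every Brownian bridge $X$ from $(0,0)$ to $(1,b)$ (a process on $[0,1]$ with almost surely continuous paths whose finite-dimensional laws are those of Brownian motion conditioned on $B(1)=b$, i.e. the weak limits as $\varepsilon\downarrow 0$ of those of $B$ conditioned on $|B(1)-b|<\varepsilon$), the random set $\mathcal V(X)$ has the same law as $\mathcal V(B)$, and the process $(\overline C_{[0,1]}X(u)-X(u),\ 0\le u\le 1)$ has the same law as $(\overline C_{[0,1]}B(u)-B(u),\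 0\le u\le 1)$. -/

import Mathlib

open MeasureTheory ProbabilityTheory Filter Topology Set
open scoped NNReal unitInterval

namespace UnitBrownian

noncomputable section

/-- The coordinates in `[0, 1]` of a finite set of times `J ⊆ [0, 1] ⊆ ℝ≥0`. -/
def time (J : Finset ℝ≥0) (hJ : ∀ t ∈ J, t ≤ 1) (t : J) : I :=
  ⟨(t : ℝ≥0), (t : ℝ≥0).2, by exact_mod_cast hJ t t.2⟩

/-- `X` is a (standard) Brownian motion on `[0, 1]`: it has the finite-dimensional laws of
Brownian motion (centered Gaussian with covariance `min s t`), and almost surely continuous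
paths. -/
structure IsBrownianMotion {Ω : Type*} [MeasurableSpace Ω] (X : I → Ω → ℝ) (P : Measure Ω) :
    Prop where
  hasLaw : ∀ (J : Finset ℝ≥0) (hJ : ∀ t ∈ J, t ≤ 1),
    HasLaw (fun ω (t : J) ↦ X (time J hJ t) ω) (BrownianReal.projectiveFamily J) P
  cont : ∀ᵐ ω ∂P, Continuous (X · ω)

/-- The restriction to `[0, 1]` of a Brownian motion on `[0, ∞)` is a Brownian motion on
`[0, 1]`. -/
theorem IsBrownianMotion.of_isBrownianReal {Ω : Type*} [MeasurableSpace Ω] {B : ℝ≥0 → Ω → ℝ}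
    {P : Measure Ω} (hB : IsBrownianReal B P) :
    IsBrownianMotion (fun u ↦ B (unitInterval.toNNReal u)) P where
  hasLaw J _ := hB.hasLaw J
  cont := by
    filter_upwards [hB.cont] with ω h
    exact h.comp unitInterval.toNNReal_continuous

/-- `X` is a Brownian bridge from `(0, 0)` to `(1, b)`: a process on `[0, 1]` with almost surely
continuous paths and with the law of Brownian motion `B` conditioned on `B 1 = b`, in the sense
that its finite-dimensional laws are the weak limits, as `ε ↓ 0`, of those of `B` conditioned on
the event `|B 1 - b| < ε`. (The finite sets of times may be taken to contain `1`.) -/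
structure IsBrownianBridge {Ω : Type*} [MeasurableSpace Ω] (b : ℝ) (X : I → Ω → ℝ)
    (P : Measure Ω) : Prop where
  aemeasurable : ∀ u, AEMeasurable (X u) P
  cont : ∀ᵐ ω ∂P, Continuous (X · ω)
  tendsto_cond : ∀ (J : Finset ℝ≥0) (hJ : ∀ t ∈ J, t ≤ 1) (h1 : 1 ∈ J)
    (φ : BoundedContinuousFunction (J → ℝ) ℝ),
    Tendsto
      (fun ε : ℝ ↦
        ∫ x, φ x ∂(cond (BrownianReal.projectiveFamily J) {x : J → ℝ | |x ⟨1, h1⟩ - b| < ε}))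
      (𝓝[>] 0)
      (𝓝 (∫ ω, φ (fun t : J ↦ X (time J hJ t) ω) ∂P))

/-- The least concave majorant of `f : [0, 1] → ℝ`: the pointwise infimum of all functions that
are concave on `[0, 1]` and dominate `f` there. -/
def concaveMajorant (f : I → ℝ) (u : I) : ℝ :=
  sInf {y | ∃ g : ℝ → ℝ, ConcaveOn ℝ (Icc 0 1) g ∧ (∀ t : I, f t ≤ g t) ∧ y = g u}

/-- The difference between the least concave majorant of `f` and `f`. -/
def majorantDiff (f : I → ℝ) (u : I) : ℝ := concaveMajorant f u - f u

/-- Subsets of `E`, as values of random sets. -/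
def SetValue (E : Type*) : Type _ := Set E

/-- The Effros σ-algebra on sets, generated by the events that the set hits a given open set `U`.
(On subsets of `[0, 1]` it is also generated by the numbers of points in the open sets.) -/
instance {E : Type*} [TopologicalSpace E] : MeasurableSpace (SetValue E) :=
  MeasurableSpace.generateFrom
    {A : Set (SetValue E) | ∃ U : Set E, IsOpen U ∧
      A = {S : SetValue E | ((show Set E from S) ∩ U).Nonempty}}

/-- The times of the vertices of the least concave majorant of `f`: the interior times `t` at
which the graph of the majorant has a vertex, i.e. the majorant is not affine in any neighbourhood
of `t`. -/
def vertexTimes (f : I → ℝ) : SetValue I :=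
  {t : I | t ∈ Ioo (0 : I) 1 ∧
    ¬ ∃ a c : ℝ, ∀ᶠ s : I in 𝓝 t, concaveMajorant f s = a + c * (s : ℝ)}

end

end UnitBrownian

namespace UnitBrownian

/-! ### The least concave majorant -/

/-! Adding an affine function to a path adds the same function to its least concave majorant, so
neither the vertex times nor the difference process changes (`vertexTimes_add_affine`,
`majorantDiff_add_affine`). Both functionals of `B` are therefore functionals of the tilted path `B
u + (b - B 1) u`, for every `b`. With `b = 0` this path is jointly Gaussian with `B 1` and
uncorrelated with it, hence independent of it (`IsBrownianMotion.indepFun_bridge`), which gives (i)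
and (ii). For general `b` its finite-dimensional laws are the conditional limits defining a bridge
(`IsBrownianMotion.tendsto_cond_bridge`), so it has the law of `X` on path space, which gives (iii).
The remaining work is measurability: both functionals are Borel on `C(I, ℝ)`, whose Borel sets are
generated by evaluations. -/

lemma concaveMajorant_le {f : I → ℝ} {g : ℝ → ℝ} (hg : ConcaveOn ℝ (Icc 0 1) g)
    (hfg : ∀ t : I, f t ≤ g t) (u : I) : concaveMajorant f u ≤ g u :=
  csInf_le ⟨f u, by rintro _ ⟨h, -, hfh, rfl⟩; exact hfh u⟩ ⟨g, hg, hfg, rfl⟩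

lemma le_concaveMajorant {f : I → ℝ} (hf : BddAbove (range f)) {u : I} {y : ℝ}
    (h : ∀ g : ℝ → ℝ, ConcaveOn ℝ (Icc 0 1) g → (∀ t : I, f t ≤ g t) → y ≤ g u) :
    y ≤ concaveMajorant f u := by
  obtain ⟨M, hM⟩ := hf
  -- The constant majorant `M` makes the set of values nonempty; otherwise `sInf` would take its
  -- default value 0.
  refine le_csInf ⟨M, fun _ ↦ M, concaveOn_const M (convex_Icc 0 1),
    fun t ↦ hM (mem_range_self t), rfl⟩ ?_
  rintro _ ⟨g, hg, hfg, rfl⟩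
  exact h g hg hfg

/-- An affine perturbation of `f` perturbs the least concave majorant at most as much. -/
lemma concaveMajorant_le_add_affine {f g : I → ℝ} (hg : BddAbove (range g)) (a c : ℝ)
    (h : ∀ t : I, f t ≤ g t + (a + c * t)) (u : I) :
    concaveMajorant f u ≤ concaveMajorant g u + (a + c * u) := by
  rw [← sub_le_iff_le_add]
  refine le_concaveMajorant hg fun k hk hgk ↦ ?_
  rw [sub_le_iff_le_add]
  have haff : ConcaveOn ℝ (Icc (0 : ℝ) 1) fun t ↦ a + c * t := by
    refine ⟨convex_Icc 0 1, fun x _ y _ p q _ _ hpq ↦ le_of_eq ?_⟩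
    simp only [smul_eq_mul]
    linear_combination a * hpq
  exact concaveMajorant_le (hk.add haff) (fun t ↦ (h t).trans (by simpa using hgk t)) u

lemma concaveMajorant_add_affine {f : I → ℝ} (hf : BddAbove (range f)) (a c : ℝ) (u : I) :
    concaveMajorant (fun t ↦ f t + (a + c * t)) u = concaveMajorant f u + (a + c * u) := by
  refine le_antisymm (concaveMajorant_le_add_affine hf a c (fun _ ↦ le_rfl) u) ?_
  have hb : BddAbove (range fun t : I ↦ f t + (a + c * t)) := by
    obtain ⟨M, hM⟩ := hf
    refine ⟨M + (|a| + |c|), ?_⟩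
    rintro _ ⟨t, rfl⟩
    have h1 : c * t ≤ |c| := (le_abs_self _).trans (by
      rw [abs_mul, abs_of_nonneg t.2.1]; exact mul_le_of_le_one_right (abs_nonneg c) t.2.2)
    have h2 := hM (mem_range_self t)
    have h3 := le_abs_self a
    simp only
    linarith
  have := concaveMajorant_le_add_affine hb (-a) (-c) (f := f) (fun t ↦ by linarith) u
  linarith

lemma majorantDiff_add_affine {f : I → ℝ} (hf : BddAbove (range f)) (a c : ℝ) :
    majorantDiff (fun t ↦ f t + (a + c * t)) = majorantDiff f := by
  ext u
  simp only [majorantDiff, concaveMajorant_add_affine hf]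
  ring

lemma vertexTimes_add_affine {f : I → ℝ} (hf : BddAbove (range f)) (a c : ℝ) :
    vertexTimes (fun t ↦ f t + (a + c * t)) = vertexTimes f := by
  unfold vertexTimes
  simp only [concaveMajorant_add_affine hf]
  refine Set.ext fun t ↦ and_congr_right fun _ ↦ not_congr ⟨?_, ?_⟩
  · rintro ⟨a', c', h⟩
    exact ⟨a' - a, c' - c, h.mono fun s hs ↦ by linear_combination hs⟩
  · rintro ⟨a', c', h⟩
    exact ⟨a' + a, c' + c, h.mono fun s hs ↦ by linear_combination hs⟩

lemma bddAbove_range_coe (f : C(I, ℝ)) : BddAbove (range f) :=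
  (isCompact_range f.continuous).bddAbove

/-- Perturbing by the constant `dist f g` shows the map is 1-Lipschitz in the sup norm. -/
lemma continuous_concaveMajorant (u : I) :
    Continuous fun f : C(I, ℝ) ↦ concaveMajorant f u := by
  refine LipschitzWith.continuous (K := 1) (LipschitzWith.of_le_add fun f g ↦ ?_)
  have := concaveMajorant_le_add_affine (f := f) (bddAbove_range_coe g) (dist f g) 0 (fun t ↦ by
    have := (abs_le.1 ((Real.dist_eq _ _).symm.le.trans (f.dist_apply_le_dist (g := g) t))).2
    linarith) u
  simpa using this

/-! ### Local and global affinity of the majorant -/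

/-- `m` is affine on `W`: any three points of its graph over `W` are collinear. -/
def Collin (m : I → ℝ) (W : Set I) : Prop :=
  ∀ s ∈ W, ∀ t ∈ W, ∀ r ∈ W,
    (m s - m t) * ((r : ℝ) - t) = (m r - m t) * ((s : ℝ) - t)

/-- The points near which `m` follows one fixed line form an open set, relatively closed in `W`
because two lines agreeing near a point coincide. -/
lemma collin_of_locally {m : I → ℝ} {W : Set I} (hW : IsPreconnected W)
    (h : ∀ t ∈ W, ∃ a c : ℝ, ∀ᶠ s : I in 𝓝 t, m s = a + c * (s : ℝ)) : Collin m W := by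
  intro s hs t ht r hr
  obtain ⟨a, c, hac⟩ := h t ht
  have key : W ⊆ {s | ∀ᶠ r : I in 𝓝 s, m r = a + c * (r : ℝ)} := by
    refine hW.subset_of_closure_inter_subset isOpen_setOfPred_eventually_nhds ⟨t, ht, hac⟩ ?_
    rintro x ⟨hx, hxW⟩
    obtain ⟨a', c', h'⟩ := h x hxW
    obtain ⟨y, hy', hy⟩ := mem_closure_iff_nhds.1 hx _ h'.eventually_nhds
    have hboth : ∀ᶠ z : I in 𝓝 y, a + c * (z : ℝ) = a' + c' * z := by
      filter_upwards [hy, hy'] with z h1 h2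
      rw [← h1, h2]
    have hyy := hboth.self_of_nhds
    -- `I` has no isolated points, so the two lines also agree at some `z ≠ y`.
    obtain ⟨z, hz, hzy⟩ := ((hboth.filter_mono nhdsWithin_le_nhds).and
      (self_mem_nhdsWithin : {y}ᶜ ∈ 𝓝[≠] y)).exists
    have hzy' : (z : ℝ) - y ≠ 0 := sub_ne_zero.2 fun e ↦ hzy (Subtype.ext e)
    have hc : c = c' := mul_right_cancel₀ hzy' (by linear_combination hz - hyy)
    subst hc
    have ha : a = a' := by linarith
    subst ha
    exact h'
  rw [(key hs).self_of_nhds, (key ht).self_of_nhds, (key hr).self_of_nhds]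
  ring

lemma Collin.eventually {m : I → ℝ} {W : Set I} (h : Collin m W) {t : I} (hW : W ∈ 𝓝 t) :
    ∃ a c : ℝ, ∀ᶠ s : I in 𝓝 t, m s = a + c * (s : ℝ) := by
  obtain ⟨r, hr, hrt⟩ := (((show ∀ᶠ x in 𝓝 t, x ∈ W from hW).filter_mono
    nhdsWithin_le_nhds).and (self_mem_nhdsWithin : {t}ᶜ ∈ 𝓝[≠] t)).exists
  have hrt' : (r : ℝ) - t ≠ 0 := sub_ne_zero.2 fun e ↦ hrt (Subtype.ext e)
  refine ⟨m t - (m r - m t) / (r - t) * t, (m r - m t) / (r - t), ?_⟩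
  filter_upwards [hW] with s hs
  have := h s hs t (mem_of_mem_nhds hW) r hr
  field_simp
  linear_combination this

/-- The points of `I` strictly between two reals. -/
def between (p q : ℝ) : Set I := Subtype.val ⁻¹' Ioo p q

lemma isPreconnected_between (p q : ℝ) : IsPreconnected (between p q) :=
  ((ordConnected_Ioo (a := p) (b := q)).preimage_mono (Subtype.mono_coe _)).isPreconnected

/-- Rational intervals turn avoidance of `U` into countably many conditions, each closed in `f` by
`isClosed_collin`. Collinearity is used because it involves no unknown slope or intercept. -/
lemma vertexTimes_inter_empty_iff (f : I → ℝ) {U : Set I} (hU : IsOpen U) :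
    ¬ ((show Set I from vertexTimes f) ∩ U).Nonempty ↔
      ∀ p q : ℚ, between p q ⊆ U ∩ Ioo 0 1 → Collin (concaveMajorant f) (between p q) := by
  constructor
  · intro h p q hpq
    refine collin_of_locally (isPreconnected_between p q) fun t ht ↦ ?_
    by_contra hcon
    exact h ⟨t, ⟨(hpq ht).2, hcon⟩, (hpq ht).1⟩
  · rintro h ⟨t, ⟨ht, hcon⟩, htU⟩
    refine hcon ?_
    have hmem : U ∩ Ioo 0 1 ∈ 𝓝 t := (hU.inter isOpen_Ioo).mem_nhds ⟨htU, ht⟩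
    obtain ⟨V, hV, hVU⟩ := mem_nhds_subtype _ _ _ |>.1 hmem
    obtain ⟨l, u, hlu, hsub⟩ := mem_nhds_iff_exists_Ioo_subset.1 hV
    obtain ⟨p, hp, hpt⟩ := exists_rat_btwn hlu.1
    obtain ⟨q, htq, hq⟩ := exists_rat_btwn hlu.2
    have hpq : Ioo (p : ℝ) q ⊆ V := (Ioo_subset_Ioo hp.le hq.le).trans hsub
    exact (h p q ((preimage_mono hpq).trans hVU)).eventually
      ((isOpen_Ioo.preimage continuous_subtype_val).mem_nhds ⟨hpt, htq⟩)

lemma isClosed_collin (W : Set I) :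
    IsClosed {f : C(I, ℝ) | Collin (concaveMajorant f) W} := by
  simp only [Collin, ofPred_forall]
  have := continuous_concaveMajorant
  exact isClosed_biInter fun s _ ↦ isClosed_biInter fun t _ ↦ isClosed_biInter fun r _ ↦
    isClosed_eq (by fun_prop) (by fun_prop)

/-! ### The path space -/

instance : MeasurableSpace C(I, ℝ) := borel _
instance : BorelSpace C(I, ℝ) := ⟨rfl⟩

lemma measurable_majorantDiff : Measurable fun f : C(I, ℝ) ↦ majorantDiff f :=
  measurable_pi_lambda _ fun u ↦
    ((continuous_concaveMajorant u).sub (by fun_prop : Continuous fun f : C(I, ℝ) ↦ f u)).measurable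

lemma measurable_vertexTimes : Measurable fun f : C(I, ℝ) ↦ vertexTimes f := by
  refine measurable_generateFrom ?_
  rintro _ ⟨U, hU, rfl⟩
  rw [← MeasurableSet.compl_iff]
  have : ((fun f : C(I, ℝ) ↦ vertexTimes f) ⁻¹'
      {S : SetValue I | ((show Set I from S) ∩ U).Nonempty})ᶜ =
      ⋂ (p : ℚ) (q : ℚ) (_ : between p q ⊆ U ∩ Ioo 0 1),
        {f : C(I, ℝ) | Collin (concaveMajorant f) (between p q)} := by
    ext f
    simpa using vertexTimes_inter_empty_iff f hU
  rw [this]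
  exact .iInter fun p ↦ .iInter fun q ↦ .iInter fun _ ↦ (isClosed_collin _).measurableSet

/-- A map into a separable metric space is measurable if the preimages of closed balls are. -/
lemma measurable_of_preimage_closedBall {Ω E : Type*} [MeasurableSpace Ω] [PseudoMetricSpace E]
    [SecondCountableTopology E] [MeasurableSpace E] [BorelSpace E] {F : Ω → E}
    (h : ∀ x r, MeasurableSet (F ⁻¹' Metric.closedBall x r)) : Measurable F := by
  refine measurable_of_isOpen fun U hU ↦ ?_
  obtain ⟨D, hDc, hD⟩ := TopologicalSpace.exists_countable_dense E
  have hUeq : U = ⋃ x ∈ D, ⋃ (r : ℚ) (_ : Metric.closedBall x (r : ℝ) ⊆ U),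
      Metric.closedBall x (r : ℝ) := by
    refine Subset.antisymm (fun y hy ↦ ?_) (by simp)
    obtain ⟨ε, hε, hεU⟩ := Metric.isOpen_iff.1 hU y hy
    obtain ⟨r, hr0, hr⟩ := exists_rat_btwn (half_pos hε)
    obtain ⟨x, hxD, hx⟩ := hD.exists_dist_lt y hr0
    simp only [mem_iUnion]
    refine ⟨x, hxD, r, fun z hz ↦ hεU ?_, Metric.mem_closedBall.2 hx.le⟩
    have hz' := Metric.mem_closedBall.1 hz
    rw [Metric.mem_ball]
    have := dist_triangle z x y
    rw [dist_comm x y] at this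
    linarith
  rw [hUeq]
  simp only [preimage_iUnion]
  exact .biUnion hDc fun x _ ↦ .iUnion fun r ↦ .iUnion fun _ ↦ h x r

/-- By continuity, a closed sup-norm ball is a countable intersection of constraints at the times in
`D`. -/
lemma measurable_of_dense {Ω : Type*} [MeasurableSpace Ω] {F : Ω → C(I, ℝ)} {D : Set I}
    (hDc : D.Countable) (hD : Dense D) (h : ∀ u ∈ D, Measurable fun ω ↦ F ω u) : Measurable F := by
  refine measurable_of_preimage_closedBall fun f r ↦ ?_
  rcases lt_or_ge r 0 with hr | hr
  · simp [Metric.closedBall_eq_empty.2 hr]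
  have : F ⁻¹' Metric.closedBall f r = ⋂ u ∈ D, {ω | |F ω u - f u| ≤ r} := by
    ext ω
    simp only [mem_preimage, Metric.mem_closedBall, ContinuousMap.dist_le hr, mem_iInter,
      mem_ofPred_eq, Real.dist_eq]
    refine ⟨fun h u _ ↦ h u, fun h u ↦ ?_⟩
    have hcl : IsClosed {u | |F ω u - f u| ≤ r} := isClosed_le (by fun_prop) continuous_const
    exact hcl.closure_subset_iff.2 (fun u hu ↦ h u hu) (hD u)
  rw [this]
  exact .biInter hDc fun u hu ↦ measurableSet_le ((h u hu).sub_const _).abs measurable_const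

/-- The Borel sets of the path space are generated by the evaluations. -/
lemma exists_preimage_coe_eq {s : Set C(I, ℝ)} (hs : MeasurableSet s) :
    ∃ t : Set (I → ℝ), MeasurableSet t ∧ (fun (f : C(I, ℝ)) u ↦ f u) ⁻¹' t = s := by
  obtain ⟨D, hDc, hD⟩ := TopologicalSpace.exists_countable_dense I
  -- The identity is measurable from the evaluation σ-algebra to the Borel one.
  have h : @Measurable _ _ (MeasurableSpace.comap (fun (f : C(I, ℝ)) u ↦ f u)
      MeasurableSpace.pi) _ (id : C(I, ℝ) → C(I, ℝ)) :=
    @measurable_of_dense _ (MeasurableSpace.comap (fun (f : C(I, ℝ)) u ↦ f u)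
      MeasurableSpace.pi) id D hDc hD fun u _ ↦
        (measurable_pi_apply u).comp (comap_measurable fun (f : C(I, ℝ)) u ↦ f u)
  exact h hs

lemma measurable_coe : Measurable fun (f : C(I, ℝ)) u ↦ f u :=
  measurable_pi_lambda _ fun u ↦ (by fun_prop : Continuous fun f : C(I, ℝ) ↦ f u).measurable

section Path

variable {Ω Ω' : Type*} [MeasurableSpace Ω] [MeasurableSpace Ω'] {P : Measure Ω} {Q : Measure Ω'}

/-- A process with almost surely continuous paths is a random element of the path space. -/
lemma exists_measurable_path {X : I → Ω → ℝ} (hX : ∀ u, AEMeasurable (X u) P)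
    (hc : ∀ᵐ ω ∂P, Continuous (X · ω)) :
    ∃ F : Ω → C(I, ℝ), Measurable F ∧ ∀ᵐ ω ∂P, ⇑(F ω) = (X · ω) := by
  classical
  obtain ⟨D, hDc, hD⟩ := TopologicalSpace.exists_countable_dense I
  -- Measurable versions are needed only at the countably many times in `D`, so one null set `N`
  -- covers all exceptions; the path is set to 0 there.
  have hS : ∀ᵐ ω ∂P, Continuous (X · ω) ∧ ∀ u ∈ D, X u ω = (hX u).mk (X u) ω :=
    hc.and ((ae_ball_iff hDc).2 fun u _ ↦ (hX u).ae_eq_mk)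
  obtain ⟨N, hN, hNm, hN0⟩ := exists_measurable_superset_of_null hS
  have hG : ∀ ω ∉ N, Continuous (X · ω) ∧ ∀ u ∈ D, X u ω = (hX u).mk (X u) ω := by
    intro ω hω
    by_contra h
    exact hω (hN h)
  refine ⟨fun ω ↦ if h : ω ∈ N then 0 else ⟨(X · ω), (hG ω h).1⟩,
    measurable_of_dense hDc hD fun u hu ↦ ?_, ?_⟩
  · have : (fun ω ↦ (if h : ω ∈ N then 0 else ⟨(X · ω), (hG ω h).1⟩ : C(I, ℝ)) u) =
        Nᶜ.indicator ((hX u).mk (X u)) := by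
      ext ω
      by_cases h : ω ∈ N
      · simp [h]
      · simp [h, (hG ω h).2 u hu]
    rw [this]
    exact (hX u).measurable_mk.indicator hNm.compl
  · have : ∀ᵐ ω ∂P, ω ∉ N := measure_eq_zero_iff_ae_notMem.1 hN0
    filter_upwards [this] with ω h
    simp [h]

/-- A finite measure on the path space is determined by its finite-dimensional marginals. -/
lemma ext_of_map_restrict {μ ν : Measure C(I, ℝ)} [IsFiniteMeasure μ] [IsFiniteMeasure ν]
    (h : ∀ J : Finset I, μ.map (fun f : C(I, ℝ) ↦ J.restrict fun u ↦ f u) =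
      ν.map (fun f : C(I, ℝ) ↦ J.restrict fun u ↦ f u)) : μ = ν := by
  have hpi : μ.map (fun f u ↦ f u) = ν.map (fun f u ↦ f u) := by
    refine IsProjectiveLimit.unique
      (P := fun J ↦ μ.map (fun f : C(I, ℝ) ↦ J.restrict fun u ↦ f u)) (fun J ↦ ?_) fun J ↦ ?_
    · rw [Measure.map_map (by fun_prop) measurable_coe]; rfl
    · rw [Measure.map_map (by fun_prop) measurable_coe]; exact (h J).symm
  ext s hs
  obtain ⟨t, ht, rfl⟩ := exists_preimage_coe_eq hs
  rw [← Measure.map_apply measurable_coe ht, hpi, Measure.map_apply measurable_coe ht]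

lemma identDistrib_path [IsFiniteMeasure P] [IsFiniteMeasure Q] {X : I → Ω → ℝ} {Y : I → Ω' → ℝ}
    {F : Ω → C(I, ℝ)} {G : Ω' → C(I, ℝ)} (hF : Measurable F) (hG : Measurable G)
    (hFX : ∀ᵐ ω ∂P, ⇑(F ω) = (X · ω)) (hGY : ∀ᵐ ω ∂Q, ⇑(G ω) = (Y · ω))
    (h : ∀ J : Finset I,
      P.map (fun ω ↦ J.restrict (X · ω)) = Q.map (fun ω ↦ J.restrict (Y · ω))) :
    IdentDistrib F G P Q := by
  refine ⟨hF.aemeasurable, hG.aemeasurable, ?_⟩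
  have hm (J : Finset I) : Measurable fun f : C(I, ℝ) ↦ J.restrict fun u ↦ f u :=
    J.measurable_restrict.comp measurable_coe
  refine ext_of_map_restrict fun J ↦ ?_
  rw [Measure.map_map (hm J) hF, Measure.map_map (hm J) hG]
  refine Eq.trans (Measure.map_congr ?_) ((h J).trans (Measure.map_congr ?_))
  · filter_upwards [hFX] with ω hω using congrArg J.restrict hω
  · filter_upwards [hGY] with ω hω using congrArg J.restrict hω.symm

lemma indepFun_path {E : Type*} [MeasurableSpace E] {X : I → Ω → ℝ} {Z : Ω → E}
    {F : Ω → C(I, ℝ)} (hFX : ∀ᵐ ω ∂P, ⇑(F ω) = (X · ω)) (h : IndepFun (fun ω u ↦ X u ω) Z P) :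
    IndepFun F Z P := by
  have h' : IndepFun (fun ω u ↦ F ω u) Z P :=
    h.congr (by filter_upwards [hFX] with ω hω using hω.symm) .rfl
  rw [indepFun_iff_measure_inter_preimage_eq_mul] at h' ⊢
  intro s t hs ht
  obtain ⟨s, hs', rfl⟩ := exists_preimage_coe_eq hs
  exact h' s t hs' ht

end Path

/-! ### The bridge of a Brownian motion -/

/-- The process `B` tilted linearly so as to end at `b`. -/
def bridge {Ω : Type*} (B : I → Ω → ℝ) (b : ℝ) (u : I) (ω : Ω) : ℝ := B u ω + (b - B 1 ω) * u

lemma majorantDiff_bridge {Ω : Type*} {B : I → Ω → ℝ} {ω : Ω} (b : ℝ)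
    (hc : Continuous (B · ω)) :
    majorantDiff (bridge B b · ω) = majorantDiff (B · ω) := by
  simpa [bridge] using majorantDiff_add_affine (bddAbove_range_coe ⟨_, hc⟩) 0 (b - B 1 ω)

lemma vertexTimes_bridge {Ω : Type*} {B : I → Ω → ℝ} {ω : Ω} (b : ℝ)
    (hc : Continuous (B · ω)) :
    vertexTimes (bridge B b · ω) = vertexTimes (B · ω) := by
  simpa [bridge] using vertexTimes_add_affine (bddAbove_range_coe ⟨_, hc⟩) 0 (b - B 1 ω)

section Bridge

variable {Ω : Type*} [MeasurableSpace Ω] {P : Measure Ω} {B : I → Ω → ℝ}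

lemma toNNReal_le_one (u : I) : unitInterval.toNNReal u ≤ 1 := u.2.2

lemma IsBrownianMotion.isGaussianProcess (hB : IsBrownianMotion B P) : IsGaussianProcess B P where
  hasGaussianLaw J := by
    classical
    have hJ : ∀ t ∈ J.image unitInterval.toNNReal, t ≤ 1 := by
      simp only [Finset.mem_image]
      rintro _ ⟨u, -, rfl⟩
      exact toNNReal_le_one u
    let L : (J.image unitInterval.toNNReal → ℝ) →L[ℝ] (J → ℝ) :=
      { toFun x u := x ⟨unitInterval.toNNReal u, Finset.mem_image_of_mem _ u.2⟩
        map_add' x y := rfl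
        map_smul' c x := rfl }
    exact (hB.hasLaw _ hJ).hasGaussianLaw.map L

lemma IsBrownianMotion.hasLaw_one (hB : IsBrownianMotion B P) :
    HasLaw (B 1) (gaussianReal 0 1) P :=
  (BrownianReal.measurePreserving_eval_projectiveFamily
    (⟨1, by simp⟩ : ({1} : Finset ℝ≥0))).hasLaw.comp (hB.hasLaw {1} (by simp))

lemma IsBrownianMotion.covariance_one (hB : IsBrownianMotion B P) (u : I) :
    cov[B u, B 1; P] = u := by
  have hJ : ∀ t ∈ ({unitInterval.toNNReal u, 1} : Finset ℝ≥0), t ≤ 1 := by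
    simp [toNNReal_le_one]
  have h := (hB.hasLaw _ hJ).covariance_fun_comp
    (f := Function.eval ⟨unitInterval.toNNReal u, by simp⟩) (g := Function.eval ⟨1, by simp⟩)
    (Measurable.aemeasurable (by fun_prop)) (Measurable.aemeasurable (by fun_prop))
  refine Eq.trans h ?_
  refine (BrownianReal.covariance_eval_projectiveFamily _ _ _).trans ?_
  simpa using u.2.2

lemma IsBrownianMotion.aemeasurable_bridge (hB : IsBrownianMotion B P) (b : ℝ) (u : I) :
    AEMeasurable (bridge B b u) P :=
  (hB.isGaussianProcess.aemeasurable u).add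
    (((hB.isGaussianProcess.aemeasurable 1).const_sub b).mul_const _)

lemma IsBrownianMotion.continuous_bridge (hB : IsBrownianMotion B P) (b : ℝ) :
    ∀ᵐ ω ∂P, Continuous (bridge B b · ω) := by
  filter_upwards [hB.cont] with ω h
  unfold bridge
  fun_prop

/-- The covariance with `B 1` is `u - u * 1 = 0`. -/
lemma IsBrownianMotion.indepFun_bridge (hB : IsBrownianMotion B P) :
    IndepFun (fun ω u ↦ bridge B 0 u ω) (B 1) P := by
  classical
  have hG := hB.isGaussianProcess
  have := hG.isProbabilityMeasure
  have hXY : IsGaussianProcess (Sum.elim (bridge B 0) fun _ : Unit ↦ B 1) P := by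
    refine hG.of_isGaussianProcess ?_
    rintro (u | -)
    · refine ⟨{u, 1}, ContinuousLinearMap.proj ⟨u, by simp⟩ -
        (u : ℝ) • ContinuousLinearMap.proj ⟨1, by simp⟩, fun ω ↦ ?_⟩
      simp [bridge]
      ring
    · exact ⟨{1}, ContinuousLinearMap.proj ⟨1, by simp⟩, fun ω ↦ by simp⟩
  have h := hXY.indepFun_of_covariance_eq_zero (hB.aemeasurable_bridge 0)
    (fun _ ↦ hG.aemeasurable 1) fun u _ ↦ by
      have h2 (s : I) : MemLp (B s) 2 P := (hG.hasGaussianLaw_eval s).memLp_two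
      have : bridge B 0 u = B u - (u : ℝ) • B 1 := by
        ext ω
        simp [bridge]
        ring
      rw [this, covariance_sub_left (h2 u) ((h2 1).const_smul _) (h2 1), covariance_smul_left,
        hB.covariance_one, hB.covariance_one]
      simp
  exact h.comp measurable_id (measurable_pi_apply ())

end Bridge

/-! ### Conditioning on the endpoint -/

/-- Averages of a bounded continuous function over shrinking balls converge. -/
lemma tendsto_integral_cond_ball {γ : Measure ℝ} [IsFiniteMeasure γ] {F : ℝ → ℝ}
    (hF : Continuous F) {C : ℝ} (hC : ∀ z, |F z| ≤ C) {b : ℝ}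
    (hγ : ∀ ε > 0, γ {z | |z - b| < ε} ≠ 0) :
    Tendsto (fun ε : ℝ ↦ ∫ z, F z ∂(cond γ {z | |z - b| < ε})) (𝓝[>] 0) (𝓝 (F b)) := by
  rw [Metric.tendsto_nhds]
  intro δ hδ
  obtain ⟨η, hη, h⟩ := Metric.continuousAt_iff.1 hF.continuousAt (δ / 2) (half_pos hδ)
  filter_upwards [Ioo_mem_nhdsGT hη] with ε hε
  have := cond_isProbabilityMeasure (hγ ε hε.1)
  have hms : MeasurableSet {z : ℝ | |z - b| < ε} :=
    measurableSet_lt (by fun_prop) measurable_const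
  have hint : Integrable F (cond γ {z | |z - b| < ε}) :=
    .of_bound hF.aestronglyMeasurable C (ae_of_all _ hC)
  have hle : ‖∫ z, (F z - F b) ∂(cond γ {z | |z - b| < ε})‖ ≤
      δ / 2 * (cond γ {z | |z - b| < ε}).real univ := by
    refine norm_integral_le_of_norm_le_const ?_
    filter_upwards [ae_cond_mem hms] with z hz
    exact (h (x := z) ((Real.dist_eq _ _).trans_lt (lt_trans hz hε.2))).le
  rw [integral_sub hint (integrable_const _)] at hle
  simp only [integral_const, probReal_univ, one_smul, mul_one] at hle
  rw [dist_eq_norm]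
  linarith

section Cond

variable {Ω Ω' : Type*} [MeasurableSpace Ω] [MeasurableSpace Ω'] {P : Measure Ω} {Q : Measure Ω'}
  {B : I → Ω → ℝ} {X : I → Ω' → ℝ} {b : ℝ}

/-- Since `B t = Y t + t * B 1` with `Y` independent of `B 1`, the conditional integral is the
average, over a window around `b`, of the continuous function `F z = E[φ(Y + t z)]`. It tends to `F
b`. -/
lemma IsBrownianMotion.tendsto_cond_bridge (hB : IsBrownianMotion B P) (b : ℝ)
    (J : Finset ℝ≥0) (hJ : ∀ t ∈ J, t ≤ 1) (h1 : 1 ∈ J)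
    (φ : BoundedContinuousFunction (J → ℝ) ℝ) :
    Tendsto
      (fun ε : ℝ ↦
        ∫ x, φ x ∂(cond (BrownianReal.projectiveFamily J) {x : J → ℝ | |x ⟨1, h1⟩ - b| < ε}))
      (𝓝[>] 0)
      (𝓝 (∫ ω, φ (fun t : J ↦ bridge B b (time J hJ t) ω) ∂P)) := by
  have := hB.isGaussianProcess.isProbabilityMeasure
  set Y : Ω → J → ℝ := fun ω t ↦ bridge B 0 (time J hJ t) ω with hY
  have hYm : AEMeasurable Y P := aemeasurable_pi_lambda _ fun t ↦ hB.aemeasurable_bridge 0 _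
  have hB1 : AEMeasurable (B 1) P := hB.isGaussianProcess.aemeasurable 1
  have hind : IndepFun Y (B 1) P := hB.indepFun_bridge.comp
    (φ := fun x (t : J) ↦ x (time J hJ t)) (measurable_pi_lambda _ fun t ↦ measurable_pi_apply _)
    measurable_id
  set ν := P.map Y
  set γ := P.map (B 1)
  have : IsProbabilityMeasure ν := Measure.isProbabilityMeasure_map hYm
  have : IsProbabilityMeasure γ := Measure.isProbabilityMeasure_map hB1
  let T : (J → ℝ) × ℝ → J → ℝ := fun p t ↦ p.1 t + ((t : ℝ≥0) : ℝ) * p.2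
  have hT : Continuous T := by fun_prop
  have hTY (ω : Ω) (z : ℝ) : T (Y ω, z) = fun t : J ↦ bridge B z (time J hJ t) ω := by
    ext t
    simp only [T, hY, bridge, time]
    ring
  have hTB (ω : Ω) : T (Y ω, B 1 ω) = fun t : J ↦ B (time J hJ t) ω := by
    rw [hTY]
    simp [bridge]
  let F : ℝ → ℝ := fun z ↦ ∫ y, φ (T (y, z)) ∂ν
  have hφT (z : ℝ) (y : J → ℝ) : ‖φ (T (y, z))‖ ≤ ‖φ‖ := φ.norm_coe_le_norm _
  have hF : Continuous F := by
    refine continuous_of_dominated (bound := fun _ ↦ ‖φ‖)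
      (fun z ↦ (by fun_prop : Continuous fun y ↦ φ (T (y, z))).aestronglyMeasurable)
      (fun z ↦ ae_of_all _ (hφT z)) (integrable_const _) (ae_of_all _ fun y ↦ by fun_prop)
  have hFb (z : ℝ) : |F z| ≤ ‖φ‖ := by
    simpa using norm_integral_le_of_norm_le_const (μ := ν) (ae_of_all _ (hφT z))
  have hγ : ∀ ε > 0, γ {z | |z - b| < ε} ≠ 0 := by
    intro ε hε h0
    rw [show γ = gaussianReal 0 1 from hB.hasLaw_one.map_eq] at h0
    have hvol := gaussianReal_absolutelyContinuous' 0 one_ne_zero h0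
    -- Lebesgue measure is absolutely continuous with respect to the Gaussian, so a window of zero
    -- Gaussian mass would be Lebesgue-null.
    refine (Metric.measure_ball_pos volume b hε).ne' ?_
    simpa [Metric.ball, Real.dist_eq] using hvol
  have hlim := tendsto_integral_cond_ball hF hFb hγ
  have hFint : F b = ∫ ω, φ (fun t : J ↦ bridge B b (time J hJ t) ω) ∂P := by
    simp only [F, ν]
    rw [integral_map hYm (by fun_prop : Continuous fun y ↦ φ (T (y, b))).aestronglyMeasurable]
    simp only [hTY]
  rw [hFint] at hlim
  refine hlim.congr fun ε ↦ ?_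
  have hs : MeasurableSet {z : ℝ | |z - b| < ε} :=
    measurableSet_lt (by fun_prop) measurable_const
  have hA : MeasurableSet {x : J → ℝ | |x ⟨1, h1⟩ - b| < ε} :=
    measurableSet_lt (by fun_prop) measurable_const
  have hlaw := hB.hasLaw J hJ
  have hmass : γ {z | |z - b| < ε} =
      BrownianReal.projectiveFamily J {x : J → ℝ | |x ⟨1, h1⟩ - b| < ε} := by
    rw [← hlaw.map_eq, Measure.map_apply_of_aemeasurable hB1 hs,
      Measure.map_apply_of_aemeasurable hlaw.aemeasurable hA]
    rfl
  have hset : ∫ z in {z | |z - b| < ε}, F z ∂γ =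
      ∫ x in {x : J → ℝ | |x ⟨1, h1⟩ - b| < ε}, φ x ∂(BrownianReal.projectiveFamily J) := by
    let H : (J → ℝ) × ℝ → ℝ :=
      ({p | |p.2 - b| < ε} : Set ((J → ℝ) × ℝ)).indicator fun p ↦ φ (T p)
    have hHs : MeasurableSet {p : (J → ℝ) × ℝ | |p.2 - b| < ε} :=
      measurableSet_lt (by fun_prop) measurable_const
    have hHm : Measurable H := (by fun_prop : Continuous fun p ↦ φ (T p)).measurable.indicator hHs
    have hHint : Integrable H (ν.prod γ) := by
      refine .of_bound hHm.aestronglyMeasurable ‖φ‖ (ae_of_all _ fun p ↦ ?_)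
      exact (norm_indicator_le_norm_self _ _).trans (φ.norm_coe_le_norm _)
    have hprod := (indepFun_iff_map_prod_eq_prod_map_map hYm hB1).1 hind
    calc ∫ z in {z | |z - b| < ε}, F z ∂γ
        = ∫ z, ∫ y, H (y, z) ∂ν ∂γ := by
          rw [← integral_indicator hs]
          refine integral_congr_ae (ae_of_all _ fun z ↦ ?_)
          by_cases hz : |z - b| < ε <;> simp [H, F, hz, indicator]
      _ = ∫ p, H p ∂(ν.prod γ) := (integral_prod_symm _ hHint).symm
      _ = ∫ ω, H (Y ω, B 1 ω) ∂P := by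
          rw [← hprod, integral_map (hYm.prodMk hB1) hHm.aestronglyMeasurable]
      _ = _ := by
          rw [← integral_indicator hA, ← hlaw.map_eq, integral_map hlaw.aemeasurable
            (φ.continuous.measurable.indicator hA).aestronglyMeasurable]
          refine integral_congr_ae (ae_of_all _ fun ω ↦ ?_)
          simp only [H, indicator, hTB]
          rfl
  simp only [ProbabilityTheory.cond, integral_smul_measure, hmass, hset]

/-- Testing both limits against the constant function 1 gives the total mass. -/
lemma IsBrownianBridge.isProbabilityMeasure (hX : IsBrownianBridge b X Q)
    (hB : IsBrownianMotion B P) : IsProbabilityMeasure Q := by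
  have := hB.isGaussianProcess.isProbabilityMeasure
  have h := tendsto_nhds_unique (hX.tendsto_cond {1} (by simp) (by simp) 1)
    (hB.tendsto_cond_bridge b {1} (by simp) (by simp) 1)
  refine ⟨?_⟩
  have h' : Q.real univ = 1 := by simpa using h
  rwa [measureReal_def, ENNReal.toReal_eq_one_iff] at h'

lemma IsBrownianBridge.map_restrict_eq (hX : IsBrownianBridge b X Q)
    (hB : IsBrownianMotion B P) (J : Finset I) :
    P.map (fun ω ↦ J.restrict (bridge B b · ω)) = Q.map (fun ω ↦ J.restrict (X · ω)) := by
  classical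
  have := hB.isGaussianProcess.isProbabilityMeasure
  have := hX.isProbabilityMeasure hB
  -- The conditioning requires time 1 in the set; `R` projects back to `J`.
  set K : Finset ℝ≥0 := insert 1 (J.image unitInterval.toNNReal)
  have hK : ∀ t ∈ K, t ≤ 1 := by
    simp only [K, Finset.mem_insert, Finset.mem_image]
    rintro _ (rfl | ⟨u, -, rfl⟩)
    · exact le_rfl
    · exact toNNReal_le_one u
  have hPm : AEMeasurable (fun ω (t : K) ↦ bridge B b (time K hK t) ω) P :=
    aemeasurable_pi_lambda _ fun t ↦ hB.aemeasurable_bridge b _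
  have hQm : AEMeasurable (fun ω (t : K) ↦ X (time K hK t) ω) Q :=
    aemeasurable_pi_lambda _ fun t ↦ hX.aemeasurable _
  have hKeq : P.map (fun ω (t : K) ↦ bridge B b (time K hK t) ω) =
      Q.map (fun ω (t : K) ↦ X (time K hK t) ω) := by
    refine ext_of_forall_integral_eq_of_IsFiniteMeasure fun φ ↦ ?_
    rw [integral_map hPm φ.continuous.aestronglyMeasurable,
      integral_map hQm φ.continuous.aestronglyMeasurable]
    exact tendsto_nhds_unique (hB.tendsto_cond_bridge b K hK (by simp [K]) φ)
      (hX.tendsto_cond K hK (by simp [K]) φ)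
  let R : (K → ℝ) → J → ℝ := fun x u ↦
    x ⟨unitInterval.toNNReal u, Finset.mem_insert_of_mem (Finset.mem_image_of_mem _ u.2)⟩
  have hR : Measurable R := by fun_prop
  have := congrArg (Measure.map R) hKeq
  rwa [AEMeasurable.map_map_of_aemeasurable hR.aemeasurable hPm,
    AEMeasurable.map_map_of_aemeasurable hR.aemeasurable hQm] at this

end Cond

end UnitBrownian

theorem mainTheorem6 {Ω : Type*} [MeasurableSpace Ω] (P : Measure Ω) (B : I → Ω → ℝ)
    (hB : UnitBrownian.IsBrownianMotion B P) :
    IndepFun (fun ω ↦ UnitBrownian.vertexTimes (B · ω)) (B 1) P ∧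
    IndepFun (fun ω ↦ UnitBrownian.majorantDiff (B · ω)) (B 1) P ∧
    ∀ (b : ℝ) {Ω' : Type*} [MeasurableSpace Ω'] (Q : Measure Ω') (X : I → Ω' → ℝ),
      UnitBrownian.IsBrownianBridge b X Q →
      IdentDistrib (fun ω ↦ UnitBrownian.vertexTimes (B · ω))
        (fun ω ↦ UnitBrownian.vertexTimes (X · ω)) P Q ∧
      IdentDistrib (fun ω ↦ UnitBrownian.majorantDiff (B · ω))
        (fun ω ↦ UnitBrownian.majorantDiff (X · ω)) P Q := by
  open UnitBrownian in
  have := hB.isGaussianProcess.isProbabilityMeasure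
  have hpath (b : ℝ) := exists_measurable_path (hB.aemeasurable_bridge b) (hB.continuous_bridge b)
  have hV {b : ℝ} {F : Ω → C(I, ℝ)} (hF : ∀ᵐ ω ∂P, ⇑(F ω) = (bridge B b · ω)) :
      (fun ω ↦ vertexTimes (F ω)) =ᵐ[P] fun ω ↦ vertexTimes (B · ω) := by
    filter_upwards [hF, hB.cont] with ω h hc
    rw [h, vertexTimes_bridge b hc]
  have hD {b : ℝ} {F : Ω → C(I, ℝ)} (hF : ∀ᵐ ω ∂P, ⇑(F ω) = (bridge B b · ω)) :
      (fun ω ↦ majorantDiff (F ω)) =ᵐ[P] fun ω ↦ majorantDiff (B · ω) := by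
    filter_upwards [hF, hB.cont] with ω h hc
    rw [h, majorantDiff_bridge b hc]
  obtain ⟨F, hFm, hF⟩ := hpath 0
  have hind := indepFun_path hF hB.indepFun_bridge
  refine ⟨(hind.comp measurable_vertexTimes measurable_id).congr (hV hF) .rfl,
    (hind.comp measurable_majorantDiff measurable_id).congr (hD hF) .rfl, ?_⟩
  intro b Ω' _ Q X hX
  have := hX.isProbabilityMeasure hB
  obtain ⟨F, hFm, hF⟩ := hpath b
  obtain ⟨G, hGm, hG⟩ := exists_measurable_path hX.aemeasurable hX.cont
  have hid := identDistrib_path hFm hGm hF hG (hX.map_restrict_eq hB)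
  -- Chain: `B`, its tilt's path version `F`, the path version `G` of `X`, then `X`; the outer links
  -- hold almost surely, the middle one in law.
  have transfer {E : Type _} [MeasurableSpace E] {Φ : (I → ℝ) → E}
      (hΦ : Measurable fun f : C(I, ℝ) ↦ Φ f)
      (h : (fun ω ↦ Φ (F ω)) =ᵐ[P] fun ω ↦ Φ (B · ω)) :
      IdentDistrib (fun ω ↦ Φ (B · ω)) (fun ω ↦ Φ (X · ω)) P Q :=
    ((IdentDistrib.of_ae_eq (hΦ.comp hFm).aemeasurable h).symm.trans (hid.comp hΦ)).trans
      (.of_ae_eq (hΦ.comp hGm).aemeasurable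
        (by filter_upwards [hG] with ω hω using congrArg Φ hω))
  exact ⟨transfer measurable_vertexTimes (hV hF), transfer measurable_majorantDiff (hD hF)⟩
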